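/- A finite simple graph is called $C_7$-free if it does not contain the cycle on $7$ vertices as a (not necessarily induced) subgraph. For every integer $n\ge 110$ with $n\equiv 26 \pmod{42}$ there exists a $C_7$-free planar graph $G$ on $n$ vertices with exactly $$e(G)=\frac{18}{7}n-\frac{48}{7}$$ edges. -/

import Mathlib

/-- A graph is planar if it can be drawn in the plane `ℝ × ℝ` (with its usual topology) without
crossings: distinct vertices are distinct points, every edge is a simple arc joining the points of
its two ends, no arc passes through a vertex in its relative interior, and the relative interior of
an arc meets no other arc. -/
def SimpleGraph.IsPlanarGraph {V : Type*} (G : SimpleGraph V) : Prop :=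
  ∃ (p : V → ℝ × ℝ) (γ : G.edgeSet → unitInterval → ℝ × ℝ),
    Function.Injective p ∧
    (∀ e, Continuous (γ e) ∧ Function.Injective (γ e)) ∧
    (∀ e, s(γ e 0, γ e 1) = Sym2.map p e.1) ∧
    (∀ e, ∀ t ∈ Set.Ioo (0 : unitInterval) 1, ∀ v, γ e t ≠ p v) ∧
    (∀ e e', e ≠ e' → ∀ t ∈ Set.Ioo (0 : unitInterval) 1, ∀ t', γ e t ≠ γ e' t')

/-! The graph is glued from octahedra along single vertices. An octahedron has 12 edges but only 6
vertices, so no 7-cycle fits inside one. If two octahedra share at most one vertex, and the graph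
recording which octahedra meet has no cycle of length at most 7, then no 7-cycle can pass through
several of them either (`cycleGraph_seven_free_blockGraph`). Each octahedron is drawn inside a
triangle spanned by one of its faces; if the triangles meet only in common corners, the union is
planar (`IsBlockDrawing.isPlanarGraph`).

The octahedra form a tube. A full layer is a ring of eight octahedra and one extra link (position
8). Consecutive layers touch in three points, placed so that the circuits around the gaps between
them also consist of eight octahedra. Layer 0 closes the tube: a central octahedron (position 3)
with three arms. A full layer contributes 9 octahedra, hence 108 edges, and 42 vertices, which gives
the slope 108/42 = 18/7. With layers 0 to k, the last one without its link, there are 9k+5 octahedra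
and 42k+26 vertices.

Layer l is drawn at scale 8^l, so the geometry reduces to integer checks within a layer and on two
consecutive layers. Short circuits of octahedra are excluded by a search in low layers, extended to
all layers by translation (`tubeSearch_eq_false`). -/

/-! ### The octahedron and its straight-line drawing in a triangle -/

/-- Adjacency in the octahedron: `i` and `i + 3` are opposite. -/
def OctaAdj (i j : Fin 6) : Prop := j ≠ i ∧ j ≠ i + 3

instance : DecidableRel OctaAdj := fun _ _ => inferInstanceAs (Decidable (_ ∧ _))

lemma OctaAdj.symm {i j : Fin 6} (h : OctaAdj i j) : OctaAdj j i := by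
  revert i j; decide

/-- Five times the barycentric coordinates of the six vertices of the octahedron. -/
def octaWeight : Fin 6 → Fin 3 → ℤ :=
  ![![5, 0, 0], ![0, 5, 0], ![0, 0, 5], ![1, 2, 2], ![2, 1, 2], ![2, 2, 1]]

/-- Barycentric coordinates of the six vertices of the octahedron. -/
noncomputable def octaCoord (i : Fin 6) (a : Fin 3) : ℝ := (octaWeight i a : ℝ) / 5

lemma octaCoord_nonneg (i : Fin 6) (a : Fin 3) : 0 ≤ octaCoord i a := by
  have h : 0 ≤ octaWeight i a := by revert i a; decide
  unfold octaCoord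
  have : (0 : ℝ) ≤ octaWeight i a := by exact_mod_cast h
  positivity

lemma octaCoord_sum (i : Fin 6) : ∑ a, octaCoord i a = 1 := by
  have h : ∑ a, octaWeight i a = 5 := by revert i; decide
  unfold octaCoord
  rw [← Finset.sum_div]
  have : ∑ a, (octaWeight i a : ℝ) = 5 := by exact_mod_cast h
  rw [this]; norm_num

lemma octaCoord_injective : Function.Injective octaCoord := by
  intro i j h
  have h1 : octaWeight i = octaWeight j := by
    ext a
    have := congrFun h a
    unfold octaCoord at this
    have h2 : (octaWeight i a : ℝ) = octaWeight j a := by linarith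
    exact_mod_cast h2
  clear h
  revert i j; decide

lemma octaCoord_castAdd (a : Fin 3) : octaCoord (Fin.castAdd 3 a) = Pi.single a 1 := by
  ext b
  have h : octaWeight (Fin.castAdd 3 a) b = 5 * Pi.single (M := fun _ => ℤ) a 1 b := by
    revert a b; decide
  unfold octaCoord
  rw [h]
  by_cases hb : b = a
  · subst hb; simp
  · simp [hb]

lemma octaCoord_eq_single {i : Fin 6} {a : Fin 3} (h : octaCoord i = Pi.single a 1) :
    i = Fin.castAdd 3 a :=
  octaCoord_injective (h.trans (octaCoord_castAdd a).symm)

/-- The point at parameter `t` on the segment from `i` to `j`, in barycentric coordinates. -/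
noncomputable def octaSeg (i j : Fin 6) (t : ℝ) (a : Fin 3) : ℝ :=
  (1 - t) * octaCoord i a + t * octaCoord j a

lemma octaSeg_zero (i j : Fin 6) : octaSeg i j 0 = octaCoord i := by
  ext a; simp [octaSeg]

lemma octaSeg_one (i j : Fin 6) : octaSeg i j 1 = octaCoord j := by
  ext a; simp [octaSeg]

lemma octaSeg_nonneg (i j : Fin 6) {t : ℝ} (h0 : 0 ≤ t) (h1 : t ≤ 1) (a : Fin 3) :
    0 ≤ octaSeg i j t a :=
  add_nonneg (mul_nonneg (by linarith) (octaCoord_nonneg i a))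
    (mul_nonneg h0 (octaCoord_nonneg j a))

lemma octaSeg_sum (i j : Fin 6) (t : ℝ) : ∑ a, octaSeg i j t a = 1 := by
  unfold octaSeg
  rw [Finset.sum_add_distrib, ← Finset.mul_sum, ← Finset.mul_sum, octaCoord_sum, octaCoord_sum]
  ring

lemma octaSeg_injective {i j : Fin 6} (h : OctaAdj i j) : Function.Injective (octaSeg i j) := by
  intro t t' ht
  by_contra hne
  refine h.1 (octaCoord_injective ?_).symm
  ext a
  have := congrFun ht a
  unfold octaSeg at this
  have h2 : (t - t') * (octaCoord i a - octaCoord j a) = 0 := by linarith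
  rcases mul_eq_zero.1 h2 with h3 | h3
  · exact absurd (sub_eq_zero.1 h3) hne
  · exact sub_eq_zero.1 h3

/-- A corner is an extreme point of the triangle: both ends of a segment through it would have to
equal it. -/
lemma octaSeg_ne_single {i j : Fin 6} (h : OctaAdj i j) {t : ℝ} (h0 : 0 < t) (h1 : t < 1)
    (a : Fin 3) : octaSeg i j t ≠ Pi.single a 1 := by
  intro he
  have key : ∀ b, b ≠ a → octaCoord i b = 0 ∧ octaCoord j b = 0 := by
    intro b hb
    have := congrFun he b
    rw [Pi.single_eq_of_ne hb] at this
    unfold octaSeg at this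
    have hi := octaCoord_nonneg i b
    have hj := octaCoord_nonneg j b
    constructor <;> nlinarith [mul_nonneg (sub_nonneg.2 h1.le) hi, mul_nonneg h0.le hj]
  have key2 : ∀ x : Fin 6, (∀ b, b ≠ a → octaCoord x b = 0) → octaCoord x = Pi.single a 1 := by
    intro x hx
    have hs := octaCoord_sum x
    rw [Finset.sum_eq_single a (fun b _ hb => hx b hb) (by simp)] at hs
    ext b
    by_cases hb : b = a
    · subst hb; simpa using hs
    · rw [hx b hb, Pi.single_eq_of_ne hb]
  exact h.1 (octaCoord_injective ((key2 j fun b hb => (key b hb).2).trans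
    (key2 i fun b hb => (key b hb).1).symm))

/-- The linear form `x ↦ det (u, v, x)`. -/
def detForm (u v x : Fin 3 → ℤ) : ℤ :=
  (u 1 * v 2 - u 2 * v 1) * x 0 + (u 2 * v 0 - u 0 * v 2) * x 1 + (u 0 * v 1 - u 1 * v 0) * x 2

/-- The separating line can always be taken through two vertices `u`, `v` of the drawing. The
strictness is asymmetric because the first edge is used without its ends and the second one with
them, so that edges with a common end are covered. -/
lemma octa_separation : ∀ i j i' j' : Fin 6, OctaAdj i j → OctaAdj i' j' → s(i, j) ≠ s(i', j') →
    (∃ u v, let f := fun x => detForm (octaWeight u) (octaWeight v) (octaWeight x)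
      (f i ≤ 0 ∧ f j ≤ 0 ∧ 0 ≤ f i' ∧ 0 ≤ f j') ∧
        ((f i < 0 ∨ f j < 0) ∨ (0 < f i' ∧ 0 < f j'))) := by
  decide +kernel

lemma octaSeg_ne {i j i' j' : Fin 6} (h : OctaAdj i j) (h' : OctaAdj i' j')
    (hne : s(i, j) ≠ s(i', j')) {t t' : ℝ} (h0 : 0 < t) (h1 : t < 1) (h0' : 0 ≤ t')
    (h1' : t' ≤ 1) : octaSeg i j t ≠ octaSeg i' j' t' := by
  intro he
  obtain ⟨u, v, ⟨a1, a2, a3, a4⟩, a5⟩ := octa_separation i j i' j' h h' hne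
  dsimp only at a1 a2 a3 a4 a5
  set F : (Fin 3 → ℝ) → ℝ := fun x =>
    ((octaWeight u 1 * octaWeight v 2 - octaWeight u 2 * octaWeight v 1 : ℤ) : ℝ) * x 0 +
    ((octaWeight u 2 * octaWeight v 0 - octaWeight u 0 * octaWeight v 2 : ℤ) : ℝ) * x 1 +
    ((octaWeight u 0 * octaWeight v 1 - octaWeight u 1 * octaWeight v 0 : ℤ) : ℝ) * x 2 with hF
  have hw : ∀ x : Fin 6, F (octaCoord x) =
      (detForm (octaWeight u) (octaWeight v) (octaWeight x) : ℤ) / 5 := by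
    intro x
    simp only [hF, octaCoord, detForm]
    push_cast
    ring
  have hseg : ∀ (x y : Fin 6) (s : ℝ), F (octaSeg x y s) =
      (1 - s) * F (octaCoord x) + s * F (octaCoord y) := by
    intro x y s
    simp only [hF, octaSeg]
    ring
  have e1 := congrArg F he
  rw [hseg, hseg, hw, hw, hw, hw] at e1
  generalize detForm (octaWeight u) (octaWeight v) (octaWeight i) = A at *
  generalize detForm (octaWeight u) (octaWeight v) (octaWeight j) = B at *
  generalize detForm (octaWeight u) (octaWeight v) (octaWeight i') = C at *
  generalize detForm (octaWeight u) (octaWeight v) (octaWeight j') = D at *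
  have b1 : (A : ℝ) ≤ 0 := by exact_mod_cast a1
  have b2 : (B : ℝ) ≤ 0 := by exact_mod_cast a2
  have b3 : (0 : ℝ) ≤ C := by exact_mod_cast a3
  have b4 : (0 : ℝ) ≤ D := by exact_mod_cast a4
  have c1 : (1 - t) * ((A : ℝ) / 5) ≤ 0 :=
    mul_nonpos_of_nonneg_of_nonpos (by linarith) (by linarith)
  have c2 : t * ((B : ℝ) / 5) ≤ 0 := mul_nonpos_of_nonneg_of_nonpos (by linarith) (by linarith)
  have c3 : 0 ≤ (1 - t') * ((C : ℝ) / 5) := mul_nonneg (by linarith) (by linarith)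
  have c4 : 0 ≤ t' * ((D : ℝ) / 5) := mul_nonneg (by linarith) (by linarith)
  rcases a5 with (a5 | a5) | ⟨a5, a6⟩
  · have d : (A : ℝ) < 0 := by exact_mod_cast a5
    have : (1 - t) * ((A : ℝ) / 5) < 0 := mul_neg_of_pos_of_neg (by linarith) (by linarith)
    linarith
  · have d : (B : ℝ) < 0 := by exact_mod_cast a5
    have : t * ((B : ℝ) / 5) < 0 := mul_neg_of_pos_of_neg (by linarith) (by linarith)
    linarith
  · have d : (0 : ℝ) < C := by exact_mod_cast a5
    have d' : (0 : ℝ) < D := by exact_mod_cast a6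
    rcases h0'.lt_or_eq with h | h
    · have : 0 < t' * ((D : ℝ) / 5) := mul_pos h (by linarith)
      linarith
    · rw [← h] at e1 c4 c3
      linarith

/-! ### Graphs glued from octahedra -/

section Blocks

variable {β V : Type*}

/-- The union of octahedra, the `b`-th one being placed on the vertices `τ b 0, …, τ b 5`. -/
def blockGraph (τ : β → Fin 6 → V) : SimpleGraph V where
  Adj u v := u ≠ v ∧ ∃ b i j, OctaAdj i j ∧ τ b i = u ∧ τ b j = v
  symm := ⟨fun _ _ ⟨h, b, i, j, hij, hi, hj⟩ => ⟨h.symm, b, j, i, hij.symm, hj, hi⟩⟩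
  loopless := ⟨fun _ h => h.1 rfl⟩

/-- The point with barycentric coordinates `w` in the triangle with corners `c`. -/
def baryPoint (c : Fin 3 → ℝ × ℝ) (w : Fin 3 → ℝ) : ℝ × ℝ := ∑ a, w a • c a

/-- The triangles with corners `A` and `B` are disjoint, or all they have in common is one corner,
whose indices in `A` and `B` are related by `R`. -/
def TrianglesSeparated (A B : Fin 3 → ℝ × ℝ) (R : Fin 3 → Fin 3 → Prop) : Prop :=
  (∀ w w', (∀ a, 0 ≤ w a) → (∀ a, 0 ≤ w' a) → ∑ a, w a = 1 → ∑ a, w' a = 1 →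
    baryPoint A w ≠ baryPoint B w') ∨
  ∃ a a', R a a' ∧
    ∀ w w', (∀ a, 0 ≤ w a) → (∀ a, 0 ≤ w' a) → ∑ a, w a = 1 → ∑ a, w' a = 1 →
      baryPoint A w = baryPoint B w' → w = Pi.single a 1 ∧ w' = Pi.single a' 1

/-- A system of octahedra drawn in triangles which meet at most in common corners. -/
structure IsBlockDrawing (τ : β → Fin 6 → V) (c : β → Fin 3 → ℝ × ℝ) : Prop where
  injective : ∀ b, Function.Injective (τ b)
  surjective : ∀ v, ∃ b i, τ b i = v
  nondegenerate : ∀ b w w', ∑ a, w a = 1 → ∑ a, w' a = 1 →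
    baryPoint (c b) w = baryPoint (c b) w' → w = w'
  separated : ∀ b b', b ≠ b' → TrianglesSeparated (c b) (c b') fun a a' =>
    τ b (Fin.castAdd 3 a) = τ b' (Fin.castAdd 3 a')
  consistent : ∀ b b' i i', τ b i = τ b' i' →
    baryPoint (c b) (octaCoord i) = baryPoint (c b') (octaCoord i')

namespace IsBlockDrawing

variable {τ : β → Fin 6 → V} {c : β → Fin 3 → ℝ × ℝ}

/-- A common vertex is drawn at a common point, and two triangles have at most one of these. -/
lemma eq_of_common (h : IsBlockDrawing τ c) {b b' : β} (hb : b ≠ b') {i j i' j' : Fin 6}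
    (h1 : τ b i = τ b' i') (h2 : τ b j = τ b' j') : i = j := by
  rcases h.separated b b' hb with hs | ⟨a, a', -, hs⟩
  · exact absurd (h.consistent _ _ _ _ h1) (hs _ _ (octaCoord_nonneg i) (octaCoord_nonneg i')
      (octaCoord_sum i) (octaCoord_sum i'))
  · rw [octaCoord_eq_single (hs _ _ (octaCoord_nonneg i) (octaCoord_nonneg i')
      (octaCoord_sum i) (octaCoord_sum i') (h.consistent _ _ _ _ h1)).1,
      octaCoord_eq_single (hs _ _ (octaCoord_nonneg j) (octaCoord_nonneg j')
      (octaCoord_sum j) (octaCoord_sum j') (h.consistent _ _ _ _ h2)).1]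

lemma eq_of_sym2_eq (h : IsBlockDrawing τ c) {b b' : β} {i j i' j' : Fin 6} (hij : OctaAdj i j)
    (he : s(τ b i, τ b j) = s(τ b' i', τ b' j')) : b = b' ∧ s(i, j) = s(i', j') := by
  have hb : b = b' := by
    by_contra hb
    rcases Sym2.eq_iff.1 he with ⟨h1, h2⟩ | ⟨h1, h2⟩
    · exact hij.1 (h.eq_of_common hb h1 h2).symm
    · exact hij.1 (h.eq_of_common hb h1 h2).symm
  subst hb
  refine ⟨rfl, ?_⟩
  rcases Sym2.eq_iff.1 he with ⟨h1, h2⟩ | ⟨h1, h2⟩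
  · rw [h.injective b h1, h.injective b h2]
  · rw [h.injective b h1, h.injective b h2, Sym2.eq_swap]

lemma adj (h : IsBlockDrawing τ c) (b : β) {i j : Fin 6} (hij : OctaAdj i j) :
    (blockGraph τ).Adj (τ b i) (τ b j) :=
  ⟨fun he => hij.1 (h.injective b he).symm, b, i, j, hij, rfl, rfl⟩

lemma exists_of_mem_edgeSet (e : (blockGraph τ).edgeSet) :
    ∃ b i j, OctaAdj i j ∧ e.1 = s(τ b i, τ b j) := by
  obtain ⟨e, he⟩ := e
  induction e with
  | h u v =>
    obtain ⟨-, b, i, j, hij, hi, hj⟩ := he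
    exact ⟨b, i, j, hij, by simp [hi, hj]⟩

lemma seg_ne (h : IsBlockDrawing τ c) {b b' : β} {i j i' j' : Fin 6} (hij : OctaAdj i j)
    (hij' : OctaAdj i' j') (hne : s(τ b i, τ b j) ≠ s(τ b' i', τ b' j')) {t t' : ℝ}
    (h0 : 0 < t) (h1 : t < 1) (h0' : 0 ≤ t') (h1' : t' ≤ 1) :
    baryPoint (c b) (octaSeg i j t) ≠ baryPoint (c b') (octaSeg i' j' t') := by
  intro he
  by_cases hb : b = b'
  · subst hb
    refine octaSeg_ne hij hij' ?_ h0 h1 h0' h1'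
      (h.nondegenerate b _ _ (octaSeg_sum _ _ _) (octaSeg_sum _ _ _) he)
    intro hs
    apply hne
    rcases Sym2.eq_iff.1 hs with ⟨rfl, rfl⟩ | ⟨rfl, rfl⟩
    · rfl
    · exact Sym2.eq_swap
  · rcases h.separated b b' hb with hs | ⟨a, a', -, hs⟩
    · exact hs _ _ (octaSeg_nonneg i j h0.le h1.le) (octaSeg_nonneg i' j' h0' h1')
        (octaSeg_sum _ _ _) (octaSeg_sum _ _ _) he
    · exact octaSeg_ne_single hij h0 h1 a
        (hs _ _ (octaSeg_nonneg i j h0.le h1.le) (octaSeg_nonneg i' j' h0' h1')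
        (octaSeg_sum _ _ _) (octaSeg_sum _ _ _) he).1

lemma continuous_baryPoint_octaSeg (b : β) (i j : Fin 6) :
    Continuous fun t : unitInterval => baryPoint (c b) (octaSeg i j t) := by
  unfold baryPoint octaSeg
  fun_prop

theorem isPlanarGraph (h : IsBlockDrawing τ c) : (blockGraph τ).IsPlanarGraph := by
  choose B I hBI using h.surjective
  choose b i j hij he using exists_of_mem_edgeSet (τ := τ)
  set p : V → ℝ × ℝ := fun v => baryPoint (c (B v)) (octaCoord (I v)) with hp
  have hpτ : ∀ b i, p (τ b i) = baryPoint (c b) (octaCoord i) := fun b i =>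
    h.consistent _ _ _ _ (hBI (τ b i))
  set γ : (blockGraph τ).edgeSet → unitInterval → ℝ × ℝ :=
    fun e t => baryPoint (c (b e)) (octaSeg (i e) (j e) t) with hγ
  have hends : ∀ e, s(γ e 0, γ e 1) = Sym2.map p e.1 := by
    intro e
    rw [he e, Sym2.map_mk, hpτ, hpτ]
    simp [hγ, octaSeg_zero, octaSeg_one]
  have hdisj : ∀ e e', e ≠ e' → ∀ t ∈ Set.Ioo (0 : unitInterval) 1, ∀ t', γ e t ≠ γ e' t' := by
    intro e e' hne t ht t'
    refine h.seg_ne (hij e) (hij e') ?_ ht.1 ht.2 t'.2.1 t'.2.2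
    rw [← he, ← he]
    exact fun hh => hne (Subtype.ext hh)
  refine ⟨p, γ, ?_, ?_, hends, ?_, hdisj⟩
  · intro v w hvw
    by_cases hb : B v = B w
    · have h1 : I v = I w := octaCoord_injective (h.nondegenerate (B v) _ _ (octaCoord_sum _)
        (octaCoord_sum _) (by simpa only [hp, hb] using hvw))
      rw [← hBI v, ← hBI w, hb, h1]
    · rcases h.separated _ _ hb with hs | ⟨a, a', haa, hs⟩
      · exact absurd hvw (hs _ _ (octaCoord_nonneg _) (octaCoord_nonneg _) (octaCoord_sum _)
          (octaCoord_sum _))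
      · obtain ⟨h1, h2⟩ := hs _ _ (octaCoord_nonneg _) (octaCoord_nonneg _) (octaCoord_sum _)
          (octaCoord_sum _) hvw
        rw [← hBI v, ← hBI w, octaCoord_eq_single h1, octaCoord_eq_single h2, haa]
  · refine fun e => ⟨continuous_baryPoint_octaSeg _ _ _, fun t t' htt => Subtype.ext ?_⟩
    exact octaSeg_injective (hij e)
      (h.nondegenerate _ _ _ (octaSeg_sum _ _ _) (octaSeg_sum _ _ _) htt)
  · intro e t ht v
    have hA : ∀ x : Fin 6, OctaAdj x (x + 1) ∧ OctaAdj x (x + 2) ∧ x + 1 ≠ x + 2 := by decide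
    obtain ⟨h1, h2, h3⟩ := hA (I v)
    -- Every vertex has degree at least 2, hence is an end of an edge other than `e`. Avoiding
    -- vertices thus follows from `hdisj`, which allows the ends of the second arc.
    have key : ∃ e' : (blockGraph τ).edgeSet, e ≠ e' ∧ v ∈ e'.1 := by
      have a1 := h.adj (B v) h1
      have a2 := h.adj (B v) h2
      by_cases hc : e.1 = s(τ (B v) (I v), τ (B v) (I v + 1))
      · refine ⟨⟨s(_, _), a2⟩, fun hh => h3 ?_, by simp [hBI]⟩
        have := congrArg Subtype.val hh
        rw [hc] at this
        simpa using (h.eq_of_sym2_eq h1 this).2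
      · exact ⟨⟨s(_, _), a1⟩, fun hh => hc (congrArg Subtype.val hh), by simp [hBI]⟩
    obtain ⟨e', hne, hv⟩ := key
    have hm : p v ∈ Sym2.map p e'.1 := Sym2.mem_map.2 ⟨v, hv, rfl⟩
    rw [← hends, Sym2.mem_iff] at hm
    rcases hm with hm | hm <;> rw [hm] <;> exact hdisj e e' hne t ht _

/-- The twelve edges of the octahedron. -/
def octaEdges : Finset (Sym2 (Fin 6)) :=
  ((Finset.univ : Finset (Fin 6 × Fin 6)).filter fun x => OctaAdj x.1 x.2).image fun x => s(x.1, x.2)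

lemma card_octaEdges : octaEdges.card = 12 := by decide +kernel

theorem ncard_edgeSet [Fintype β] (h : IsBlockDrawing τ c) :
    (blockGraph τ).edgeSet.ncard = 12 * Fintype.card β := by
  have hmem : ∀ s : Sym2 (Fin 6), s ∈ octaEdges ↔ ∃ i j, OctaAdj i j ∧ s = s(i, j) := by
    intro s
    simp [octaEdges, eq_comm]
  have hset : (blockGraph τ).edgeSet =
      Set.range fun x : β × octaEdges => Sym2.map (τ x.1) x.2.1 := by
    ext e
    constructor
    · intro he
      obtain ⟨b, i, j, hij, hh⟩ := exists_of_mem_edgeSet ⟨e, he⟩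
      exact ⟨⟨b, s(i, j), (hmem _).2 ⟨i, j, hij, rfl⟩⟩, hh.symm⟩
    · rintro ⟨⟨b, s, hs⟩, rfl⟩
      obtain ⟨i, j, hij, rfl⟩ := (hmem s).1 hs
      exact h.adj b hij
  rw [hset, ← Set.image_univ, Set.ncard_image_of_injective, Set.ncard_univ, Nat.card_prod,
    Nat.card_eq_fintype_card, Nat.card_eq_fintype_card, Fintype.card_coe, card_octaEdges, mul_comm]
  rintro ⟨b, s, hs⟩ ⟨b', s', hs'⟩ hh
  obtain ⟨i, j, hij, rfl⟩ := (hmem s).1 hs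
  obtain ⟨i', j', hij', rfl⟩ := (hmem s').1 hs'
  obtain ⟨rfl, h2⟩ := h.eq_of_sym2_eq hij hh
  simp [h2]

end IsBlockDrawing

/-! ### Excluding 7-cycles -/

/-- Two blocks share a vertex. -/
def BlocksMeet (τ : β → Fin 6 → V) (b b' : β) : Prop := b ≠ b' ∧ ∃ i i', τ b i = τ b' i'

/-- There is a walk without immediate reversals, of length at most `n`, which leads from `x` to `t`
and does not start with a step to `p`. -/
def ReachWithin {α : Type*} (R : α → α → Prop) : ℕ → α → α → α → Prop
  | 0, _, x, t => x = t
  | n + 1, p, x, t => x = t ∨ ∃ d, d ≠ p ∧ R x d ∧ ReachWithin R n x d t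

lemma ReachWithin.succ {α : Type*} {R : α → α → Prop} {n : ℕ} {p x t : α}
    (h : ReachWithin R n p x t) : ReachWithin R (n + 1) p x t := by
  induction n generalizing p x with
  | zero => exact Or.inl h
  | succ n ih =>
    rcases h with h | ⟨d, hd, hr, h⟩
    · exact Or.inl h
    · exact Or.inr ⟨d, hd, hr, ih h⟩

/-- Assign to each edge of a 7-cycle a block containing it. If the block changes somewhere, going
once around from there yields a closed walk of blocks of length at most 7 without reversals, which
`hreach` forbids. -/
theorem cycleGraph_seven_free_blockGraph {τ : β → Fin 6 → V}
    (hcommon : ∀ b b' i j i' j', b ≠ b' → τ b i = τ b' i' → τ b j = τ b' j' → i = j)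
    (hreach : ∀ b t, BlocksMeet τ b t → ¬ ReachWithin (BlocksMeet τ) 6 t b t) :
    (SimpleGraph.cycleGraph 7).Free (blockGraph τ) := by
  rintro ⟨⟨f, hf⟩⟩
  have hadj : ∀ x : Fin 7, ∃ b i j, τ b i = f x ∧ τ b j = f (x + 1) := by
    intro x
    have h1 : (SimpleGraph.cycleGraph 7).Adj x (x + 1) := by revert x; decide
    obtain ⟨-, b, i, j, -, hi, hj⟩ := f.map_adj h1
    exact ⟨b, i, j, hi, hj⟩
  choose b I J hI hJ using hadj
  by_cases hconst : ∀ x, b x = b (x + 1)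
  · have hb : ∀ x, b x = b 0 := by
      intro x
      induction x using Fin.induction with
      | zero => rfl
      | succ x ih => rw [← ih, hconst x.castSucc, Fin.coeSucc_eq_succ]
    have hinj : Function.Injective I := by
      intro x y hxy
      apply hf
      rw [← hI x, ← hI y, hb x, hb y, hxy]
    simpa using Fintype.card_le_of_injective I hinj
  · push Not at hconst
    obtain ⟨x, hx⟩ := hconst
    -- Here `x + 1 + z` is the current edge, `p` the previous block, and `f (x + 1 + y)` the vertex
    -- at which the current block was entered; `m` edges remain.
    have hstep : ∀ m : ℕ, ∀ y z : Fin 7, z.val + m = 6 → y ≤ z → ∀ p i, p ≠ b (x + 1 + z) →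
        τ p i = f (x + 1 + y) → (∃ i', τ (b (x + 1 + z)) i' = f (x + 1 + y)) →
        ReachWithin (BlocksMeet τ) m p (b (x + 1 + z)) (b x) := by
      intro m
      induction m with
      | zero =>
        intro y z hz _ p i _ _ _
        have : z = 6 := by ext; simpa using hz
        subst this
        change _ = _
        congr 1
        clear hx
        have : ∀ x : Fin 7, x + 1 + 6 = x := by decide
        exact this x
      | succ m ih =>
        rintro y z hz hyz p i hp hi ⟨i', hi'⟩
        have hz1 : (z + 1).val = z.val + 1 := by
          rw [Fin.val_add_one_of_lt]
          rw [Fin.lt_def]; simp; omega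
        have hassoc : x + 1 + z + 1 = x + 1 + (z + 1) := by rw [add_assoc]
        have hyz1 : y < z + 1 := by rw [Fin.lt_def, hz1]; rw [Fin.le_def] at hyz; omega
        by_cases hbb : b (x + 1 + z) = b (x + 1 + (z + 1))
        · rw [hbb]
          exact (ih y (z + 1) (by omega) hyz1.le p i (hbb ▸ hp) hi ⟨i', hbb ▸ hi'⟩).succ
        · have hJ' := hJ (x + 1 + z)
          have hI' := hI (x + 1 + (z + 1))
          rw [hassoc] at hJ'
          refine Or.inr ⟨b (x + 1 + (z + 1)), ?_, ⟨hbb, _, _, hJ'.trans hI'.symm⟩,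
            ih (z + 1) (z + 1) (by omega) le_rfl _ _ hbb hJ' ⟨_, hI'⟩⟩
          rintro rfl
          -- A return to the previous block would make it share both the entry and the exit vertex
          -- with the current one; these are distinct since `y < z + 1`.
          have := hcommon _ _ _ _ _ _ hbb (hi'.trans hi.symm) (hJ'.trans hI'.symm)
          rw [← this] at hJ'
          have h3 := hf (hi'.symm.trans hJ')
          exact hyz1.ne (add_left_cancel h3)
    have hfin := hstep 6 0 0 rfl le_rfl (b x) (J x) (by simpa using hx) (by simpa using hJ x)
      ⟨I (x + 1), by simpa using hI (x + 1)⟩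
    rw [add_zero] at hfin
    exact hreach (b (x + 1)) (b x) ⟨hx.symm, _, _, (hI (x + 1)).trans (hJ x).symm⟩ hfin

end Blocks

/-! ### Separating triangles with integral corners -/

/-- Twice the signed area of the triangle `u`, `v`, `x`. -/
def area (u v x : ℤ × ℤ) : ℤ := (v.1 - u.1) * (x.2 - u.2) - (v.2 - u.2) * (x.1 - u.1)

/-- The corners `A` as points of the plane, scaled by `μ`. -/
noncomputable def scaled (μ : ℝ) (A : Fin 3 → ℤ × ℤ) (a : Fin 3) : ℝ × ℝ :=
  (μ * (A a).1, μ * (A a).2)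

lemma baryPoint_scaled (μ : ℝ) (A : Fin 3 → ℤ × ℤ) (w : Fin 3 → ℝ) :
    baryPoint (scaled μ A) w = (μ * ∑ a, w a * (A a).1, μ * ∑ a, w a * (A a).2) := by
  simp only [baryPoint, scaled, Fin.sum_univ_three, Prod.smul_mk, Prod.mk_add_mk, smul_eq_mul]
  congr 1 <;> ring

lemma baryPoint_single (A : Fin 3 → ℝ × ℝ) (a : Fin 3) : baryPoint A (Pi.single a 1) = A a := by
  unfold baryPoint
  rw [Finset.sum_eq_single a (fun b _ hb => by simp [hb]) (by simp)]
  simp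

/-- The value of an affine function at a point given by barycentric coordinates. -/
lemma area_bary (u v : ℤ × ℤ) (A : Fin 3 → ℤ × ℤ) {w : Fin 3 → ℝ} (hw : ∑ a, w a = 1) :
    ∑ a, w a * (area u v (A a) : ℝ) =
      ((v.1 - u.1 : ℤ) : ℝ) * ((∑ a, w a * (A a).2) - u.2) -
        ((v.2 - u.2 : ℤ) : ℝ) * ((∑ a, w a * (A a).1) - u.1) := by
  simp only [Fin.sum_univ_three, area] at *
  have : w 0 = 1 - w 1 - w 2 := by linarith
  rw [this]
  push_cast
  ring

/-- The signed area over a side vanishes at the two ends of that side, so its value at a point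
determines the third barycentric coordinate. -/
lemma eq_of_baryPoint_eq {μ : ℝ} (hμ : 0 < μ) {A : Fin 3 → ℤ × ℤ}
    (hA : area (A 0) (A 1) (A 2) ≠ 0) {w w' : Fin 3 → ℝ} (hw : ∑ a, w a = 1)
    (hw' : ∑ a, w' a = 1) (h : baryPoint (scaled μ A) w = baryPoint (scaled μ A) w') : w = w' := by
  rw [baryPoint_scaled, baryPoint_scaled, Prod.mk.injEq] at h
  have h1 := mul_left_cancel₀ hμ.ne' h.1
  have h2 := mul_left_cancel₀ hμ.ne' h.2
  have hA' : (area (A 0) (A 1) (A 2) : ℝ) ≠ 0 := by exact_mod_cast hA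
  have key : ∀ u v, ∑ a, w a * (area u v (A a) : ℝ) = ∑ a, w' a * (area u v (A a) : ℝ) := by
    intro u v
    rw [area_bary u v A hw, area_bary u v A hw', h1, h2]
  have k2 := key (A 0) (A 1)
  have k1 := key (A 2) (A 0)
  have e : ∀ u v : ℤ × ℤ, area u v u = 0 ∧ area u v v = 0 := fun u v => by
    constructor <;> unfold area <;> ring
  have e1 : area (A 2) (A 0) (A 1) = area (A 0) (A 1) (A 2) := by unfold area; ring
  simp only [Fin.sum_univ_three, (e _ _).1, (e _ _).2, e1, Int.cast_zero, mul_zero, add_zero,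
    zero_add] at k1 k2 hw hw'
  have g2 := mul_right_cancel₀ hA' k2
  have g1 := mul_right_cancel₀ hA' k1
  ext a
  fin_cases a
  · simp only [Fin.zero_eta]; linarith
  · exact g1
  · exact g2

/-- Some side of the triangle `A` has `B` strictly on its far side, except for at most one corner
of `B`, which then is a corner of `A`. -/
def OneSided (A B : Fin 3 → ℤ × ℤ) (R : Fin 3 → Fin 3 → Prop) : Prop :=
  ∃ i k, (∀ a, area (A i) (A k) (A a) ≤ 0) ∧
    ((∀ a, 0 < area (A i) (A k) (B a)) ∨
      ∃ a a', R a a' ∧ A a = B a' ∧ 0 ≤ area (A i) (A k) (B a') ∧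
        ∀ x, x ≠ a' → 0 < area (A i) (A k) (B x))

instance (A B : Fin 3 → ℤ × ℤ) (R : Fin 3 → Fin 3 → Prop) [∀ a, DecidablePred (R a)] :
    Decidable (OneSided A B R) :=
  inferInstanceAs (Decidable (∃ i k, (∀ a, area (A i) (A k) (A a) ≤ 0) ∧
    ((∀ a, 0 < area (A i) (A k) (B a)) ∨
      ∃ a a', R a a' ∧ A a = B a' ∧ 0 ≤ area (A i) (A k) (B a') ∧
        ∀ x, x ≠ a' → 0 < area (A i) (A k) (B x))))

lemma TrianglesSeparated.symm {A B : Fin 3 → ℝ × ℝ} {R R' : Fin 3 → Fin 3 → Prop}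
    (h : TrianglesSeparated A B R) (hR : ∀ a a', R a a' → R' a' a) : TrianglesSeparated B A R' := by
  rcases h with h | ⟨a, a', haa, h⟩
  · exact Or.inl fun w w' h1 h2 h3 h4 he => h w' w h2 h1 h4 h3 he.symm
  · exact Or.inr ⟨a', a, hR _ _ haa, fun w w' h1 h2 h3 h4 he =>
      (h w' w h2 h1 h4 h3 he.symm).symm⟩

/-- At a common point the affine form of the side is nonpositive, seen from `A`, and a nonnegative
combination of its values at `B`. All weight then sits on the exceptional corner, if there is one.
-/
lemma OneSided.trianglesSeparated {A B : Fin 3 → ℤ × ℤ} {R : Fin 3 → Fin 3 → Prop}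
    (h : OneSided A B R) (hA : area (A 0) (A 1) (A 2) ≠ 0) {μ : ℝ} (hμ : 0 < μ) :
    TrianglesSeparated (scaled μ A) (scaled μ B) R := by
  obtain ⟨i, k, hneg, hpos⟩ := h
  have key : ∀ w w' : Fin 3 → ℝ, (∀ a, 0 ≤ w a) → ∑ a, w a = 1 → ∑ a, w' a = 1 →
      baryPoint (scaled μ A) w = baryPoint (scaled μ B) w' →
      ∑ a, w' a * (area (A i) (A k) (B a) : ℝ) ≤ 0 := by
    intro w w' h0 hw hw' he
    rw [baryPoint_scaled, baryPoint_scaled, Prod.mk.injEq] at he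
    rw [area_bary _ _ _ hw', ← mul_left_cancel₀ hμ.ne' he.1, ← mul_left_cancel₀ hμ.ne' he.2,
      ← area_bary _ _ _ hw]
    exact Finset.sum_nonpos fun a _ =>
      mul_nonpos_of_nonneg_of_nonpos (h0 a) (by exact_mod_cast hneg a)
  have zero : ∀ w' : Fin 3 → ℝ, (∀ a, 0 ≤ w' a) → (∀ a, 0 ≤ area (A i) (A k) (B a)) →
      ∑ a, w' a * (area (A i) (A k) (B a) : ℝ) ≤ 0 →
      ∀ a, 0 < area (A i) (A k) (B a) → w' a = 0 := by
    intro w' h0 hB hs a ha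
    have h1 : ∀ b ∈ Finset.univ, 0 ≤ w' b * (area (A i) (A k) (B b) : ℝ) := fun b _ =>
      mul_nonneg (h0 b) (by exact_mod_cast hB b)
    have h2 := (Finset.sum_eq_zero_iff_of_nonneg h1).1 (le_antisymm hs (Finset.sum_nonneg h1)) a
      (Finset.mem_univ a)
    have h3 : (area (A i) (A k) (B a) : ℝ) ≠ 0 := by exact_mod_cast ha.ne'
    exact (mul_eq_zero.1 h2).resolve_right h3
  rcases hpos with hpos | ⟨a, a', hR, hab, hz, hpos⟩
  · refine Or.inl fun w w' h0 h0' hw hw' he => ?_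
    have := zero w' h0' (fun a => (hpos a).le) (key w w' h0 hw hw' he)
    simp [fun a => this a (hpos a)] at hw'
  · refine Or.inr ⟨a, a', hR, fun w w' h0 h0' hw hw' he => ?_⟩
    have hB : ∀ x, 0 ≤ area (A i) (A k) (B x) := fun x => by
      by_cases hx : x = a'
      · exact hx ▸ hz
      · exact (hpos x hx).le
    have hzero := zero w' h0' hB (key w w' h0 hw hw' he)
    have hw'' : w' = Pi.single a' 1 := by
      rw [Finset.sum_eq_single a' (fun b _ hb => hzero b (hpos b hb)) (by simp)] at hw'
      ext x
      by_cases hx : x = a'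
      · subst hx; simpa using hw'
      · rw [hzero x (hpos x hx), Pi.single_eq_of_ne hx]
    refine ⟨?_, hw''⟩
    refine eq_of_baryPoint_eq hμ hA hw (by simp) (he.trans ?_)
    rw [hw'', baryPoint_single, baryPoint_single]
    simp [scaled, hab]

/-! ### A tube of octahedra -/

/-- Labels of the vertices of the nine octahedra in a layer of the tube: labels below `42` belong to
the previous layer. If the argument is true, this is the layer which closes the tube; it consists
of the last six octahedra. -/
def label : Bool → Fin 9 → Fin 6 → ℕ
  | true =>
  ![![53, 54, 55, 63, 64, 65], ![53, 54, 55, 63, 64, 65], ![53, 54, 55, 63, 64, 65], ![53, 54, 55,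
  63, 64, 65], ![57, 77, 61, 66, 67, 68], ![53, 56, 58, 69, 70, 71], ![54, 57, 60, 72, 73, 74],
  ![55, 78, 62, 75, 76, 80], ![56, 79, 59, 81, 82, 83]]
  | false =>
  ![![42, 43, 37, 53, 54, 55], ![43, 44, 50, 56, 57, 58], ![44, 45, 35, 59, 60, 61], ![45, 46, 51,
  62, 63, 64], ![46, 47, 77, 65, 66, 67], ![47, 48, 36, 68, 69, 70], ![48, 49, 52, 71, 72, 73],
  ![49, 42, 78, 74, 75, 76], ![50, 79, 80, 81, 82, 83]]

/-- The corners of the triangles in which the nine octahedra of a layer are drawn. -/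
def corner : Bool → Fin 9 → Fin 3 → ℤ × ℤ
  | true =>
  ![![(16, 0), (0, 16), (-16, -16)], ![(16, 0), (0, 16), (-16, -16)], ![(16, 0), (0, 16), (-16,
  -16)], ![(16, 0), (0, 16), (-16, -16)], ![(0, 32), (0, 48), (8, 40)], ![(16, 0), (32, 0), (24,
  8)], ![(0, 16), (0, 32), (8, 24)], ![(-16, -16), (-48, -48), (-32, -24)], ![(32, 0), (48, 0),
  (40, 8)]]
  | false =>
  ![![(0, -24), (24, 0), (6, 0)], ![(24, 0), (24, 24), (36, 0)], ![(24, 24), (6, 24), (0, 6)],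
  ![(6, 24), (-6, 24), (0, 30)], ![(-6, 24), (-24, 0), (0, 48)], ![(-24, 0), (-24, -18), (-6,
  -6)], ![(-24, -18), (-18, -24), (-24, -24)], ![(-18, -24), (0, -24), (-48, -48)], ![(36, 0),
  (48, 0), (42, 6)]]

/-- Which octahedra are present in a layer. -/
def IsPresent (s : Bool) (r : Fin 9) : Prop := s = true → 3 ≤ r

instance (s : Bool) (r : Fin 9) : Decidable (IsPresent s r) :=
  inferInstanceAs (Decidable (_ → _))

/-- The octahedra meeting the octahedron `x.2` in layer `x.1`. -/
def tubeNeighbors (x : ℕ × Fin 9) : List (ℕ × Fin 9) :=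
  if x.1 = 0 then
    ![[], [], [], [(0, 5), (0, 6), (0, 7)], [(0, 6), (1, 2)], [(0, 3), (0, 8)], [(0, 3), (0, 4)],
      [(0, 3), (1, 5)], [(0, 5), (1, 0)]] x.2
  else
    (![[(1, 1), (1, 7), (0, 8)], [(1, 0), (1, 2), (1, 8)], [(1, 1), (1, 3), (0, 4)],
      [(1, 2), (1, 4)], [(1, 3), (1, 5), (2, 2)], [(1, 4), (1, 6), (0, 7)], [(1, 5), (1, 7)],
      [(1, 6), (1, 0), (2, 5)], [(1, 1), (2, 0)]] x.2 : List (ℕ × Fin 9)).map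
      fun d => (x.1 - 1 + d.1, d.2)

/-- A computable form of `ReachWithin` for the tube. -/
def tubeSearch : ℕ → ℕ × Fin 9 → ℕ × Fin 9 → ℕ × Fin 9 → Bool
  | 0, _, x, t => x = t
  | n + 1, p, x, t => x = t || (tubeNeighbors x).any fun d => d ≠ p && tubeSearch n x d t

/-! ### Translation invariance of the search -/

/-- The translation to the next layer. -/
def nextLayer (x : ℕ × Fin 9) : ℕ × Fin 9 := (x.1 + 1, x.2)

lemma nextLayer_injective : Function.Injective nextLayer := by
  rintro ⟨a, b⟩ ⟨a', b'⟩ h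
  simpa [nextLayer] using h

lemma tubeNeighbors_nextLayer {x : ℕ × Fin 9} (hx : 1 ≤ x.1) :
    tubeNeighbors (nextLayer x) = (tubeNeighbors x).map nextLayer := by
  unfold tubeNeighbors
  rw [if_neg (by simp [nextLayer]), if_neg (by omega), List.map_map]
  apply List.map_congr_left
  intro d _
  simp only [nextLayer, Function.comp_apply, Prod.mk.injEq, and_true]
  omega

lemma le_fst_of_mem_tubeNeighbors {x d : ℕ × Fin 9} (h : d ∈ tubeNeighbors x) :
    x.1 ≤ d.1 + 1 := by
  unfold tubeNeighbors at h
  split_ifs at h with h0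
  · omega
  · obtain ⟨y, -, rfl⟩ := List.mem_map.1 h
    change x.1 ≤ x.1 - 1 + y.1 + 1
    omega

/-- A step descends at most one layer, so with `n ≤ x.1` every vertex that gets expanded lies in
layer at least 1, where the neighbour lists are translates of each other. -/
lemma tubeSearch_nextLayer {n : ℕ} {p x t : ℕ × Fin 9} (hx : n ≤ x.1) :
    tubeSearch n (nextLayer p) (nextLayer x) (nextLayer t) = tubeSearch n p x t := by
  induction n generalizing p x with
  | zero => simp [tubeSearch, nextLayer_injective.eq_iff]
  | succ n ih =>
    rw [tubeSearch, tubeSearch, tubeNeighbors_nextLayer (by omega), List.any_map, Bool.eq_iff_iff]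
    simp only [nextLayer_injective.eq_iff, Bool.or_eq_true, List.any_eq_true, Function.comp_apply,
      Bool.and_eq_true, ne_eq, decide_eq_true_eq]
    refine or_congr Iff.rfl (exists_congr fun d => and_congr_right fun hd => ?_)
    have := le_fst_of_mem_tubeNeighbors hd
    rw [ih (by omega)]

lemma tubeSearch_eq_false_of_lt : ∀ l < 7, ∀ r : Fin 9, ∀ t ∈ tubeNeighbors (l, r),
    tubeSearch 6 t (l, r) t = false := by
  decide +kernel

lemma tubeSearch_eq_false (l : ℕ) : ∀ r : Fin 9, ∀ t ∈ tubeNeighbors (l, r),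
    tubeSearch 6 t (l, r) t = false := by
  induction l with
  | zero => exact tubeSearch_eq_false_of_lt 0 (by norm_num)
  | succ l ih =>
    by_cases hl : l + 1 < 7
    · exact tubeSearch_eq_false_of_lt _ hl
    · intro r t ht
      have h1 : ((l + 1, r) : ℕ × Fin 9) = nextLayer (l, r) := rfl
      rw [h1, tubeNeighbors_nextLayer (by change 1 ≤ l; omega)] at ht
      obtain ⟨t', ht', rfl⟩ := List.mem_map.1 ht
      rw [h1, tubeSearch_nextLayer (by change 6 ≤ l; omega)]
      exact ih r t' ht'

/-! ### Finite checks on a layer and on two consecutive layers -/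

/-- Labels lie in an interval shorter than 84 = 2 · 42, so only blocks in equal or consecutive
layers can share a vertex. The labels from 79 on occur only at position 8, which the last layer
lacks. -/
lemma label_bounds : ∀ s r i, IsPresent s r →
    35 ≤ label s r i ∧ label s r i < 84 ∧ (s = true → 53 ≤ label s r i) ∧
      (s = false → r ≠ 8 → label s r i < 79) := by
  decide +kernel

lemma exists_label_eq : ∀ s, ∀ q : Fin 42, (s = true → 11 ≤ q.val) → ∃ r i, IsPresent s r ∧
    label s r i = 42 + q.val ∧ (s = false → (q.val < 37 → r ≠ 8)) := by
  decide +kernel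

lemma label_injective : ∀ s r, IsPresent s r → Function.Injective (label s r) := by
  have : ∀ s r i j, IsPresent s r → label s r i = label s r j → i = j := by decide +kernel
  exact fun s r h i j => this s r i j h

/-- Absent positions of the closing layer repeat a genuine triangle, so no presence hypothesis is
needed. -/
lemma area_corner_ne_zero : ∀ s r, area (corner s r 0) (corner s r 1) (corner s r 2) ≠ 0 := by
  decide +kernel

/-- The separating side may belong to either triangle. -/
lemma oneSided_same : ∀ s r r', IsPresent s r → IsPresent s r' → r ≠ r' →
    OneSided (corner s r) (corner s r')
      (fun a a' => label s r (Fin.castAdd 3 a) = label s r' (Fin.castAdd 3 a')) ∨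
    OneSided (corner s r') (corner s r)
      (fun a' a => label s r (Fin.castAdd 3 a) = label s r' (Fin.castAdd 3 a')) := by
  decide +kernel

lemma oneSided_next : ∀ s r r', IsPresent s r →
    OneSided (corner s r) (fun a => 8 • corner false r' a)
      (fun a a' => label s r (Fin.castAdd 3 a) = label false r' (Fin.castAdd 3 a') + 42) ∨
    OneSided (fun a => 8 • corner false r' a) (corner s r)
      (fun a' a => label s r (Fin.castAdd 3 a) = label false r' (Fin.castAdd 3 a') + 42) := by
  decide +kernel

lemma label_same : ∀ s r r' i i', IsPresent s r → IsPresent s r' → r ≠ r' →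
    label s r i = label s r' i' →
    (∃ a a', i = Fin.castAdd 3 a ∧ i' = Fin.castAdd 3 a' ∧ corner s r a = corner s r' a') ∧
      ((!s).toNat, r') ∈ tubeNeighbors ((!s).toNat, r) := by
  decide +kernel

lemma label_next : ∀ s r r' i i', IsPresent s r → label s r i = label false r' i' + 42 →
    (∃ a a', i = Fin.castAdd 3 a ∧ i' = Fin.castAdd 3 a' ∧
      corner s r a = 8 • corner false r' a') ∧
      ((!s).toNat + 1, r') ∈ tubeNeighbors ((!s).toNat, r) ∧
      ((!s).toNat, r) ∈ tubeNeighbors ((!s).toNat + 1, r') := by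
  decide +kernel

/-- Six linear forms, as pairs of coefficients. -/
def gaugeForm : Fin 6 → ℤ × ℤ := ![(1, 0), (0, 1), (-1, 0), (0, -1), (1, -1), (-1, 1)]

/-- The six forms bound a hexagon. A layer lies inside the hexagon of size 48, and by `le_gaugeForm`
each triangle of a full layer lies beyond one side of the hexagon of size 6. Since 8 · 6 = 48,
consecutive layers fit together at scale factor 8. -/
lemma gaugeForm_le : ∀ s r m a,
    (gaugeForm m).1 * (corner s r a).1 + (gaugeForm m).2 * (corner s r a).2 ≤ 48 := by
  decide +kernel

lemma le_gaugeForm : ∀ r, ∃ m, ∀ a,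
    6 ≤ (gaugeForm m).1 * (corner false r a).1 + (gaugeForm m).2 * (corner false r a).2 := by
  decide +kernel

/-! ### The tube with a given number of layers -/

section Tube

variable {k : ℕ}

/-- The layer of a block. -/
def blockLayer (b : Fin (9 * k + 5)) : ℕ := (b.val + 3) / 9

/-- The position of a block in its layer. -/
def blockType (b : Fin (9 * k + 5)) : Fin 9 := ⟨(b.val + 3) % 9, Nat.mod_lt _ (by norm_num)⟩

/-- Whether a block belongs to the closing layer. -/
def blockKind (b : Fin (9 * k + 5)) : Bool := blockLayer b = 0

/-- The layer and the position of a block. -/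
def blockCode (b : Fin (9 * k + 5)) : ℕ × Fin 9 := (blockLayer b, blockType b)

/-- The shift by 3 accounts for the positions 0, 1, 2 missing in layer 0. -/
lemma val_add_three (b : Fin (9 * k + 5)) : b.val + 3 = 9 * blockLayer b + (blockType b).val := by
  unfold blockLayer blockType
  dsimp only
  omega

lemma blockCode_injective : Function.Injective (blockCode (k := k)) := by
  intro b b' h
  have h1 := val_add_three b
  have h2 := val_add_three b'
  have h3 : blockLayer b = blockLayer b' := congrArg Prod.fst h
  have h4 : blockType b = blockType b' := congrArg Prod.snd h
  rw [h3, h4] at h1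
  ext
  omega

lemma blockKind_eq_false {b : Fin (9 * k + 5)} (h : blockLayer b ≠ 0) : blockKind b = false := by
  simp [blockKind, h]

lemma isPresent_block (b : Fin (9 * k + 5)) : IsPresent (blockKind b) (blockType b) := by
  intro h
  have h1 := val_add_three b
  have h2 : blockLayer b = 0 := by simpa [blockKind] using h
  rw [Fin.le_def]
  change 3 ≤ _
  omega

lemma blockLayer_le (b : Fin (9 * k + 5)) :
    blockLayer b < k ∨ blockLayer b = k ∧ blockType b ≠ 8 := by
  have h1 := val_add_three b
  have h2 := b.isLt
  have h3 := (blockType b).isLt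
  by_cases h : blockLayer b < k
  · exact Or.inl h
  · refine Or.inr ⟨by omega, fun h8 => ?_⟩
    rw [h8] at h1
    change _ = _ + 8 at h1
    omega

lemma exists_block {l : ℕ} {r : Fin 9} (hl : l = 0 → 3 ≤ r) (hlk : l < k ∨ l = k ∧ r ≠ 8) :
    ∃ b : Fin (9 * k + 5), blockLayer b = l ∧ blockType b = r := by
  have h3 := r.isLt
  have h1 : 3 ≤ 9 * l + r.val := by
    by_cases h : l = 0
    · have := hl h
      rw [Fin.le_def] at this
      change 3 ≤ r.val at this
      omega
    · omega
  have h2 : 9 * l + r.val - 3 < 9 * k + 5 := by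
    rcases hlk with h | ⟨rfl, h⟩
    · omega
    · have : r.val ≠ 8 := fun hh => h (Fin.ext hh)
      omega
  refine ⟨⟨9 * l + r.val - 3, h2⟩, ?_, Fin.ext ?_⟩
  · simp only [blockLayer]; omega
  · simp only [blockType]; omega

/-- The number of a vertex of a block. -/
def tubeVertexVal (b : Fin (9 * k + 5)) (i : Fin 6) : ℕ :=
  -- The smallest label in layer 0 is 53, so the subtraction is never truncated
  -- (`tubeVertexVal_add`).
  42 * blockLayer b + label (blockKind b) (blockType b) i - 53

lemma tubeVertexVal_add (b : Fin (9 * k + 5)) (i : Fin 6) :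
    tubeVertexVal b i + 53 = 42 * blockLayer b + label (blockKind b) (blockType b) i := by
  obtain ⟨h1, -, h2, -⟩ := label_bounds (blockKind b) (blockType b) i (isPresent_block b)
  unfold tubeVertexVal
  by_cases h : blockLayer b = 0
  · have := h2 (by simp [blockKind, h])
    omega
  · omega

lemma tubeVertexVal_lt (hk : 1 ≤ k) (b : Fin (9 * k + 5)) (i : Fin 6) :
    tubeVertexVal b i < 42 * k + 26 := by
  have h := tubeVertexVal_add b i
  obtain ⟨-, h1, -, h2⟩ := label_bounds (blockKind b) (blockType b) i (isPresent_block b)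
  rcases blockLayer_le b with h3 | ⟨h3, h4⟩
  · omega
  · have := h2 (blockKind_eq_false (by omega)) h4
    omega

/-- The vertices of a block. -/
def tubeVertex (hk : 1 ≤ k) (b : Fin (9 * k + 5)) (i : Fin 6) : Fin (42 * k + 26) :=
  ⟨tubeVertexVal b i, tubeVertexVal_lt hk b i⟩

/-- The corners of the triangle in which a block is drawn. -/
noncomputable def tubeCorner (b : Fin (9 * k + 5)) : Fin 3 → ℝ × ℝ :=
  scaled (8 ^ blockLayer b) (corner (blockKind b) (blockType b))

lemma tubeVertex_eq_iff (hk : 1 ≤ k) {b b' : Fin (9 * k + 5)} {i i' : Fin 6} :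
    tubeVertex hk b i = tubeVertex hk b' i' ↔
      42 * blockLayer b + label (blockKind b) (blockType b) i =
        42 * blockLayer b' + label (blockKind b') (blockType b') i' := by
  rw [← tubeVertexVal_add, ← tubeVertexVal_add, tubeVertex, tubeVertex, Fin.mk.injEq]
  omega

lemma layers_of_tubeVertex_eq (hk : 1 ≤ k) {b b' : Fin (9 * k + 5)} {i i' : Fin 6}
    (h : tubeVertex hk b i = tubeVertex hk b' i') :
    blockLayer b = blockLayer b' ∨ blockLayer b' = blockLayer b + 1 ∨
      blockLayer b = blockLayer b' + 1 := by
  rw [tubeVertex_eq_iff] at h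
  obtain ⟨h1, h2, -⟩ := label_bounds (blockKind b) (blockType b) i (isPresent_block b)
  obtain ⟨h3, h4, -⟩ := label_bounds (blockKind b') (blockType b') i' (isPresent_block b')
  omega

lemma tubeVertex_surjective (hk : 1 ≤ k) (v : Fin (42 * k + 26)) :
    ∃ b i, tubeVertex hk b i = v := by
  have hv := v.isLt
  -- A layer introduces the labels 42 + q with q < 42, so v + 53 = 42 l + 42 + q; hence the 11.
  set l := (v.val + 11) / 42 with hl
  set q := (v.val + 11) % 42 with hq
  have hvl : v.val + 11 = 42 * l + q := by omega
  have h11 : decide (l = 0) = true → 11 ≤ q := fun h => by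
    have : l = 0 := by simpa using h
    omega
  obtain ⟨r, i, hr, hri, h8⟩ := exists_label_eq (decide (l = 0)) ⟨q, Nat.mod_lt _ (by norm_num)⟩ h11
  obtain ⟨b, hb, hb'⟩ := exists_block (k := k) (l := l) (r := r)
    (fun h => hr (by simpa using h)) (by
      by_cases h : l < k
      · exact Or.inl h
      · exact Or.inr ⟨by omega, h8 (by simp; omega) (by change q < 37; omega)⟩)
  refine ⟨b, i, Fin.ext ?_⟩
  have h1 := tubeVertexVal_add b i
  have hkind : blockKind b = decide (l = 0) := by simp [blockKind, hb]
  rw [hkind, hb, hb', hri] at h1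
  dsimp only at h1
  change tubeVertexVal b i = _
  omega

lemma kind_eq_of_layer_eq {b b' : Fin (9 * k + 5)} (h : blockLayer b = blockLayer b') :
    blockKind b = blockKind b' := by
  simp [blockKind, h]

lemma blockType_ne {b b' : Fin (9 * k + 5)} (hb : b ≠ b') (h : blockLayer b = blockLayer b') :
    blockType b ≠ blockType b' := fun h' => hb (blockCode_injective (Prod.ext h h'))

/-- Blocks with a common vertex, up to exchanging them. -/
lemma common_vertex_cases (hk : 1 ≤ k) {P : Fin (9 * k + 5) → Fin (9 * k + 5) → Fin 6 → Fin 6 → Prop}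
    (hsymm : ∀ b b' i i', P b b' i i' → P b' b i' i)
    (hsame : ∀ b b' i i', b ≠ b' → blockLayer b = blockLayer b' →
      blockKind b = blockKind b' → blockType b ≠ blockType b' →
      label (blockKind b) (blockType b) i = label (blockKind b) (blockType b') i' → P b b' i i')
    (hnext : ∀ b b' i i', blockLayer b' = blockLayer b + 1 → blockKind b' = false →
      label (blockKind b) (blockType b) i = label false (blockType b') i' + 42 → P b b' i i')
    {b b' : Fin (9 * k + 5)} {i i' : Fin 6} (hb : b ≠ b')
    (h : tubeVertex hk b i = tubeVertex hk b' i') : P b b' i i' := by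
  have h' := (tubeVertex_eq_iff hk).1 h
  rcases layers_of_tubeVertex_eq hk h with hl | hl | hl
  · have hs := kind_eq_of_layer_eq hl
    refine hsame _ _ _ _ hb hl hs (blockType_ne hb hl) ?_
    rw [← hs] at h'
    omega
  · have hs : blockKind b' = false := blockKind_eq_false (by omega)
    refine hnext _ _ _ _ hl hs ?_
    rw [hs] at h'
    omega
  · have hs : blockKind b = false := blockKind_eq_false (by omega)
    refine hsymm _ _ _ _ (hnext _ _ _ _ hl hs ?_)
    rw [hs] at h'
    omega

lemma baryPoint_octaCoord_castAdd (A : Fin 3 → ℝ × ℝ) (a : Fin 3) :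
    baryPoint A (octaCoord (Fin.castAdd 3 a)) = A a := by
  rw [octaCoord_castAdd, baryPoint_single]

lemma scaled_succ (l : ℕ) (A : Fin 3 → ℤ × ℤ) :
    scaled (8 ^ (l + 1)) A = scaled (8 ^ l) fun a => 8 • A a := by
  ext a <;> simp [scaled] <;> ring

lemma tube_consistent (hk : 1 ≤ k) (b b' : Fin (9 * k + 5)) (i i' : Fin 6)
    (h : tubeVertex hk b i = tubeVertex hk b' i') :
    baryPoint (tubeCorner b) (octaCoord i) = baryPoint (tubeCorner b') (octaCoord i') := by
  by_cases hb : b = b'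
  · subst hb
    rw [tubeVertex_eq_iff] at h
    rw [label_injective _ _ (isPresent_block b) (Nat.add_left_cancel h)]
  · refine common_vertex_cases hk (P := fun b b' i i' => baryPoint (tubeCorner b) (octaCoord i) =
      baryPoint (tubeCorner b') (octaCoord i')) (fun _ _ _ _ h => h.symm) ?_ ?_ hb h
    · intro b b' i i' _ hl hs hne hlab
      obtain ⟨⟨a, a', rfl, rfl, hc⟩, -⟩ := label_same _ _ _ i i' (isPresent_block b)
        (hs ▸ isPresent_block b') hne hlab
      rw [baryPoint_octaCoord_castAdd, baryPoint_octaCoord_castAdd]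
      simp only [tubeCorner, scaled, ← hl, ← hs, hc]
    · intro b b' i i' hl hs hlab
      obtain ⟨⟨a, a', rfl, rfl, hc⟩, -⟩ := label_next _ _ _ i i' (isPresent_block b) hlab
      rw [baryPoint_octaCoord_castAdd, baryPoint_octaCoord_castAdd]
      simp only [tubeCorner, hl, hs, scaled_succ]
      simp only [scaled, hc]

/-- The infinite tube is searched, so only this inclusion is needed and the upper end of the finite
tube plays no role. The finite checks cover the lowest layers; `shift` and `shift'` translate them
upwards. -/
lemma mem_tubeNeighbors (hk : 1 ≤ k) {b b' : Fin (9 * k + 5)}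
    (h : BlocksMeet (tubeVertex hk) b b') : blockCode b' ∈ tubeNeighbors (blockCode b) := by
  obtain ⟨hb, i, i', h⟩ := h
  have shift : ∀ (l : ℕ) (r : Fin 9) (d : ℕ) (r' : Fin 9),
      (1 + d, r') ∈ tubeNeighbors (1, r) → (l + 1 + d, r') ∈ tubeNeighbors (l + 1, r) := by
    intro l r d r' hm
    induction l with
    | zero => simpa using hm
    | succ l ih =>
      have := List.mem_map_of_mem (f := nextLayer) ih
      rw [← tubeNeighbors_nextLayer (by simp)] at this
      have e : l + 1 + 1 + d = l + 1 + d + 1 := by ring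
      rw [e]
      exact this
  have shift' : ∀ (l : ℕ) (r r' : Fin 9),
      (1, r') ∈ tubeNeighbors (2, r) → (l + 1, r') ∈ tubeNeighbors (l + 2, r) := by
    intro l r r' hm
    induction l with
    | zero => simpa using hm
    | succ l ih =>
      have := List.mem_map_of_mem (f := nextLayer) ih
      rw [← tubeNeighbors_nextLayer (by simp)] at this
      exact this
  have hz : ∀ b : Fin (9 * k + 5), blockLayer b = 0 ∧ blockKind b = true ∨
      ∃ l, blockLayer b = l + 1 ∧ blockKind b = false := by
    intro b
    by_cases h : blockLayer b = 0
    · exact Or.inl ⟨h, by simp [blockKind, h]⟩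
    · exact Or.inr ⟨blockLayer b - 1, by omega, blockKind_eq_false h⟩
  refine (common_vertex_cases hk (P := fun b b' _ _ =>
    blockCode b' ∈ tubeNeighbors (blockCode b) ∧ blockCode b ∈ tubeNeighbors (blockCode b'))
    (fun _ _ _ _ h => h.symm) ?_ ?_ hb h).1
  · intro b b' i i' _ hl hs hne hlab
    have m1 := (label_same _ _ _ i i' (isPresent_block b) (hs ▸ isPresent_block b') hne hlab).2
    have m2 := (label_same _ _ _ i' i (hs ▸ isPresent_block b') (isPresent_block b) hne.symm
      hlab.symm).2
    simp only [blockCode, ← hl]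
    rcases hz b with ⟨h0, h1⟩ | ⟨l, h0, h1⟩
    · rw [h1] at m1 m2
      rw [h0]
      exact ⟨m1, m2⟩
    · rw [h1] at m1 m2
      rw [h0]
      exact ⟨shift l _ 0 _ m1, shift l _ 0 _ m2⟩
  · intro b b' i i' hl hs hlab
    obtain ⟨-, m1, m2⟩ := label_next _ _ _ i i' (isPresent_block b) hlab
    simp only [blockCode, hl]
    rcases hz b with ⟨h0, h1⟩ | ⟨l, h0, h1⟩
    · rw [h1] at m1 m2
      rw [h0]
      exact ⟨m1, m2⟩
    · rw [h1] at m1 m2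
      rw [h0]
      exact ⟨shift l _ 1 _ m1, shift' l _ _ m2⟩

lemma tubeSearch_of_reachWithin (hk : 1 ≤ k) {n : ℕ} {p x t : Fin (9 * k + 5)}
    (h : ReachWithin (BlocksMeet (tubeVertex hk)) n p x t) :
    tubeSearch n (blockCode p) (blockCode x) (blockCode t) = true := by
  induction n generalizing p x with
  | zero =>
    obtain rfl : x = t := h
    simp [tubeSearch]
  | succ n ih =>
    rcases h with rfl | ⟨d, hd, hm, h⟩
    · simp [tubeSearch]
    · simp only [tubeSearch, Bool.or_eq_true, List.any_eq_true, Bool.and_eq_true]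
      exact Or.inr ⟨_, mem_tubeNeighbors hk hm,
        by simpa using fun hh => hd (blockCode_injective hh), ih h⟩

lemma tube_not_reachWithin (hk : 1 ≤ k) (b t : Fin (9 * k + 5))
    (h : BlocksMeet (tubeVertex hk) b t) :
    ¬ ReachWithin (BlocksMeet (tubeVertex hk)) 6 t b t := fun h' => by
  have h1 := tubeSearch_of_reachWithin hk h'
  have h2 := tubeSearch_eq_false _ _ _ (mem_tubeNeighbors hk h)
  change tubeSearch 6 (blockCode t) (blockCode b) (blockCode t) = false at h2
  rw [h1] at h2
  exact Bool.noConfusion h2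

/-! ### Separation of the triangles of the tube -/

lemma area_smul (A : Fin 3 → ℤ × ℤ) (hA : area (A 0) (A 1) (A 2) ≠ 0) :
    area (8 • A 0) (8 • A 1) (8 • A 2) ≠ 0 := by
  have : area (8 • A 0) (8 • A 1) (8 • A 2) = 64 * area (A 0) (A 1) (A 2) := by
    simp [area]; ring
  rw [this]
  exact mul_ne_zero (by norm_num) hA

lemma gauge_baryPoint (g : ℤ × ℤ) (μ : ℝ) (A : Fin 3 → ℤ × ℤ) (w : Fin 3 → ℝ) :
    g.1 * (baryPoint (scaled μ A) w).1 + g.2 * (baryPoint (scaled μ A) w).2 =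
      μ * ∑ a, w a * ((g.1 * (A a).1 + g.2 * (A a).2 : ℤ) : ℝ) := by
  rw [baryPoint_scaled]
  simp only [Fin.sum_univ_three]
  push_cast
  ring

/-- On the outer triangle some gauge form is at least 6 · 64 = 384 times the inner scale, on the
inner one at most 48 times it. -/
lemma trianglesSeparated_far (hk : 1 ≤ k) {b b' : Fin (9 * k + 5)}
    (h : blockLayer b + 2 ≤ blockLayer b') :
    TrianglesSeparated (tubeCorner b) (tubeCorner b') fun a a' =>
      tubeVertex hk b (Fin.castAdd 3 a) = tubeVertex hk b' (Fin.castAdd 3 a') := by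
  refine Or.inl fun w w' h0 h0' hw hw' he => ?_
  obtain ⟨m, hm⟩ := le_gaugeForm (blockType b')
  have e := congrArg (fun x : ℝ × ℝ => ((gaugeForm m).1 : ℝ) * x.1 + (gaugeForm m).2 * x.2) he
  dsimp only [tubeCorner] at e
  rw [gauge_baryPoint, gauge_baryPoint, blockKind_eq_false (b := b') (by omega)] at e
  have u1 : ∑ a, w a * (((gaugeForm m).1 * (corner (blockKind b) (blockType b) a).1 +
      (gaugeForm m).2 * (corner (blockKind b) (blockType b) a).2 : ℤ) : ℝ) ≤ 48 := by
    calc _ ≤ ∑ a, w a * (48 : ℝ) := Finset.sum_le_sum fun a _ =>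
          mul_le_mul_of_nonneg_left (by exact_mod_cast gaugeForm_le _ _ m a) (h0 a)
      _ = 48 := by rw [← Finset.sum_mul, hw, one_mul]
  have u2 : 6 ≤ ∑ a, w' a * (((gaugeForm m).1 * (corner false (blockType b') a).1 +
      (gaugeForm m).2 * (corner false (blockType b') a).2 : ℤ) : ℝ) := by
    calc (6 : ℝ) = ∑ a, w' a * (6 : ℝ) := by rw [← Finset.sum_mul, hw', one_mul]
      _ ≤ _ := Finset.sum_le_sum fun a _ =>
          mul_le_mul_of_nonneg_left (by exact_mod_cast hm a) (h0' a)
  have hpos : (0 : ℝ) < 8 ^ blockLayer b := by positivity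
  have hpow : (8 : ℝ) ^ blockLayer b * 64 ≤ 8 ^ blockLayer b' := by
    calc (8 : ℝ) ^ blockLayer b * 64 = 8 ^ (blockLayer b + 2) := by ring
      _ ≤ _ := pow_le_pow_right₀ (by norm_num) h
  nlinarith [mul_le_mul_of_nonneg_left u1 hpos.le,
    mul_le_mul_of_nonneg_left u2 (hpos.le.trans (by linarith : _ ≤ (8 : ℝ) ^ blockLayer b'))]

lemma trianglesSeparated_next (hk : 1 ≤ k) {b b' : Fin (9 * k + 5)}
    (h : blockLayer b' = blockLayer b + 1) :
    TrianglesSeparated (tubeCorner b) (tubeCorner b') fun a a' =>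
      tubeVertex hk b (Fin.castAdd 3 a) = tubeVertex hk b' (Fin.castAdd 3 a') := by
  have hs : blockKind b' = false := blockKind_eq_false (by omega)
  have hpos : (0 : ℝ) < 8 ^ blockLayer b := by positivity
  have hR : ∀ a a', label (blockKind b) (blockType b) (Fin.castAdd 3 a) =
      label false (blockType b') (Fin.castAdd 3 a') + 42 →
      tubeVertex hk b (Fin.castAdd 3 a) = tubeVertex hk b' (Fin.castAdd 3 a') := by
    intro a a' hh
    rw [tubeVertex_eq_iff, hs, h, hh]
    ring
  have hc : tubeCorner b' =
      scaled (8 ^ blockLayer b) fun a => 8 • corner false (blockType b') a := by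
    rw [tubeCorner, h, hs, scaled_succ]
  rw [hc, tubeCorner]
  rcases oneSided_next _ _ (blockType b') (isPresent_block b) with hh | hh
  -- Reversing twice only serves to pass from the relation on labels to the one on vertices.
  · exact ((hh.trianglesSeparated (area_corner_ne_zero _ _) hpos).symm
      (R' := fun a' a => tubeVertex hk b (Fin.castAdd 3 a) = tubeVertex hk b' (Fin.castAdd 3 a'))
      hR).symm fun _ _ hh => hh
  · exact (hh.trianglesSeparated (area_smul _ (area_corner_ne_zero _ _)) hpos).symm
      fun a' a => hR a a'

lemma trianglesSeparated_same (hk : 1 ≤ k) {b b' : Fin (9 * k + 5)} (hb : b ≠ b')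
    (h : blockLayer b = blockLayer b') :
    TrianglesSeparated (tubeCorner b) (tubeCorner b') fun a a' =>
      tubeVertex hk b (Fin.castAdd 3 a) = tubeVertex hk b' (Fin.castAdd 3 a') := by
  have hs := kind_eq_of_layer_eq h
  have hpos : (0 : ℝ) < 8 ^ blockLayer b := by positivity
  have hR : ∀ a a', label (blockKind b) (blockType b) (Fin.castAdd 3 a) =
      label (blockKind b) (blockType b') (Fin.castAdd 3 a') →
      tubeVertex hk b (Fin.castAdd 3 a) = tubeVertex hk b' (Fin.castAdd 3 a') := by
    intro a a' hh
    rw [tubeVertex_eq_iff, ← hs, ← h, hh]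
  have hc : tubeCorner b' =
      scaled (8 ^ blockLayer b) (corner (blockKind b) (blockType b')) := by
    rw [tubeCorner, ← h, ← hs]
  rw [hc, tubeCorner]
  rcases oneSided_same _ _ (blockType b') (isPresent_block b) (hs ▸ isPresent_block b')
    (blockType_ne hb h) with hh | hh
  · exact ((hh.trianglesSeparated (area_corner_ne_zero _ _) hpos).symm
      (R' := fun a' a => tubeVertex hk b (Fin.castAdd 3 a) = tubeVertex hk b' (Fin.castAdd 3 a'))
      hR).symm fun _ _ hh => hh
  · exact (hh.trianglesSeparated (area_corner_ne_zero _ _) hpos).symm fun a' a => hR a a'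

theorem tube_isBlockDrawing (hk : 1 ≤ k) :
    IsBlockDrawing (tubeVertex hk) (tubeCorner (k := k)) where
  injective b i j h :=
    label_injective _ _ (isPresent_block b) (Nat.add_left_cancel ((tubeVertex_eq_iff hk).1 h))
  surjective := tubeVertex_surjective hk
  nondegenerate b w w' hw hw' h :=
    eq_of_baryPoint_eq (by positivity) (area_corner_ne_zero _ _) hw hw' h
  separated b b' hb := by
    rcases lt_trichotomy (blockLayer b) (blockLayer b') with h | h | h
    · rcases Nat.lt_or_ge (blockLayer b + 1) (blockLayer b') with h2 | h2
      · exact trianglesSeparated_far hk h2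
      · exact trianglesSeparated_next hk (by omega)
    · exact trianglesSeparated_same hk hb h
    · rcases Nat.lt_or_ge (blockLayer b' + 1) (blockLayer b) with h2 | h2
      · exact (trianglesSeparated_far hk h2).symm fun _ _ hh => hh.symm
      · exact (trianglesSeparated_next hk (by omega)).symm fun _ _ hh => hh.symm
  consistent := tube_consistent hk

end Tube

theorem mainTheorem6 (n : ℕ) (hn : 110 ≤ n) (hmod : n ≡ 26 [MOD 42]) :
    ∃ G : SimpleGraph (Fin n),
      G.IsPlanarGraph ∧
      (SimpleGraph.cycleGraph 7).Free G ∧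
      (G.edgeSet.ncard : ℝ) = 18 / 7 * (n : ℝ) - 48 / 7 := by
  obtain ⟨k, rfl⟩ : ∃ k, n = 42 * k + 26 := ⟨n / 42, by unfold Nat.ModEq at hmod; omega⟩
  have hk : 1 ≤ k := by omega
  have h := tube_isBlockDrawing hk
  refine ⟨blockGraph (tubeVertex hk), h.isPlanarGraph,
    cycleGraph_seven_free_blockGraph (fun _ _ _ _ _ _ hb h1 h2 => h.eq_of_common hb h1 h2)
      (tube_not_reachWithin hk), ?_⟩
  rw [h.ncard_edgeSet, Fintype.card_fin]
  push_cast
  ring
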